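/- **Setting.** Let $A\in\mathbb{R}[t]^{n\times n}$ and $r\ge 0$. Perturbations of $A$ have the form $\Delta A=\sum_{s=1}^m c_sE_s$ with given $E_s\in\mathbb{R}[t]^{n\times n}$ (for example the monomial matrices $t^ke_ie_j^T$ with $k\le\deg A_{ij}$, in which case $c=\mathrm{vec}(\Delta A)$). For vectors $b_1,\dots,b_r\in\mathbb{R}[t]^{n}$ with prescribed finite sets of unknown coefficients (all other coefficients are $0$), write $\widehat b_j$ for the vector of unknown coefficients of $b_j$, and let $\widehat{\mathcal A}_j+\widehat{\Delta\mathcal A}_j$ be the block-Toeplitz matrix with $(\widehat{\mathcal A}_j+\widehat{\Delta\mathcal A}_j)\widehat b_j$ = the vector of the coefficients of $(A+\Delta A)b_j$ in a prescribed finite set of positions (the scalar equations that are kept; trivial or redundant ones may be dropped). Let $\mathcal N_j$ be normalization maps of class $C^3$ (for example constant, or $\mathcal N_j(\widehat b)=\widehat b$). Put $x=(c,\widehat b_1,\dots,\widehat b_r)$, let $M(x)$ be the vector of all residuals $(\widehat{\mathcal A}_j+\widehat{\Delta\mathcal A}_j)\widehat b_j$ and $\mathcal N_j(\widehat b_j)^T\widehat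 b_j-1$, $1\le j\le r$, let $J=\nabla_xM$, and $$L(x,\lambda)=\|\Delta A\|_F^2+\lambda^TM(x),$$ where $\|\cdot\|_F^2$ is the sum of the squares of all coefficients. Let $(x^\star,\lambda^\star)$ be an optimal primal-dual pair in the sense of the second-order sufficiency conditions: $\nabla L(x^\star,\lambda^\star)=0$ and $u^T\nabla^2_{xx}L(x^\star,\lambda^\star)u>0$ for all $u\ne0$ with $J(x^\star)u=0$. **Iteration.** From $(x^k,\lambda^k)$ with $\nabla L(x^k,\lambda^k)\neq 0$ put $x^{k+1}=x^k+\Delta x$, $\lambda^{k+1}=\lambda^k+\Delta\lambda$, where $$\begin{pmatrix}\nabla^2_{xx}L & J^T\\ J&-\mu_kI\end{pmatrix}\begin{pmatrix}\Delta x\\ \Delta\lambda\end{pmatrix}=-\nabla L,\qquad \mu_k=\|\nabla L(x^k,\lambda^k)\|_1,$$ everything being evaluated at $(x^k,\lambda^k)$; if $\nabla L(x^k,\lambda^k)=0$ the iteration stays at $(x^k,\lambda^k)$. **Theorem.** There are $\rho>0$ and $C>0$ such that for every $(x^0,\lambda^0)$ with $\|(x^0,\lambda^0)-(x^\star,\lambda^\star)\|<\rho$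 the iteration is well defined (there is exactly one sequence of iterates), and it converges quadratically to $(x^\star,\hat\lambda)$ for some multiplier $\hat\lambda$, that is, $$(x^k,\lambda^k)\to(x^\star,\hat\lambda),\qquad \|(x^{k+1},\lambda^{k+1})-(x^\star,\hat\lambda)\|\le C\,\|(x^k,\lambda^k)-(x^\star,\hat\lambda)\|^2\quad(k\ge0),$$ where $\nabla L(x^\star,\hat\lambda)=0$ and $\|\hat\lambda-\lambda^\star\|\le C\|(x^0,\lambda^0)-(x^\star,\lambda^\star)\|$. If $J(x^\star)$ has full row rank, then $\hat\lambda=\lambda^\star$, so that the iterates converge quadratically to $(x^\star,\lambda^\star)$. (The choice of norm only affects $\rho$ and $C$.) -/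

import Mathlib

open scoped Matrix

noncomputable section

/-! Calculus in coordinates. -/

/-- The gradient `(∂f/∂x_i)_i` of `f : ℝ^σ → ℝ` at `x`. -/
def gradVec {σ : Type*} [Fintype σ] [DecidableEq σ] (f : (σ → ℝ) → ℝ) (x : σ → ℝ) : σ → ℝ :=
  fun i => fderiv ℝ f x (Pi.single i 1)

/-- The Hessian matrix `(∂²f/∂x_i∂x_j)_{i,j}` of `f : ℝ^σ → ℝ` at `x`. -/
def hessMat {σ : Type*} [Fintype σ] [DecidableEq σ] (f : (σ → ℝ) → ℝ) (x : σ → ℝ) :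
    Matrix σ σ ℝ :=
  Matrix.of fun i j => gradVec (fun y => gradVec f y j) x i

/-- The Jacobian matrix `(∂M_a/∂x_i)_{a,i}` of `M : ℝ^σ → ℝ^τ` at `x`. -/
def jacMat {σ τ : Type*} [Fintype σ] [DecidableEq σ] (M : (σ → ℝ) → (τ → ℝ)) (x : σ → ℝ) :
    Matrix τ σ ℝ :=
  Matrix.of fun a => gradVec (fun y => M y a) x

/-- The 1-norm of a coordinate vector. -/
def l1Norm {σ : Type*} [Fintype σ] (v : σ → ℝ) : ℝ := ∑ i, |v i|

/-- Quadratic (quotient-rate) convergence of `w` to `l`, with constant `C`. -/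
def QuadraticallyConverges {E : Type*} [NormedAddCommGroup E] (w : ℕ → E) (l : E) (C : ℝ) :
    Prop :=
  Filter.Tendsto w Filter.atTop (nhds l) ∧ ∀ k, ‖w (k + 1) - l‖ ≤ C * ‖w k - l‖ ^ 2

/-! Matrix polynomials and their real embeddings. -/

/-- The entry in row `l` and column `k` of the Toeplitz matrix `φ(a)` of multiplication by the
polynomial `a`: it is `a_{l-k}`, and `0` above the diagonal. -/
def toeplitz (a : Polynomial ℝ) (l k : ℕ) : ℝ := if k ≤ l then a.coeff (l - k) else 0

/-- The real embedding of a matrix polynomial: the block matrix with blocks `φ(A_{ij})`. A row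
`(i, l)` stands for the coefficient of `t^l` in the `i`-th entry of a product `A b`, a column
`(j, k)` for the coefficient of `t^k` in the `j`-th entry of `b`. Exponents range over `ℕ`; only
finite submatrices are used below. -/
def realEmbedding {n : ℕ} (A : Matrix (Fin n) (Fin n) (Polynomial ℝ)) :
    Matrix (Fin n × ℕ) (Fin n × ℕ) ℝ :=
  Matrix.of fun p q => toeplitz (A p.1 q.1) p.2 q.2

/-- The squared Frobenius norm of a matrix polynomial: the sum of the squares of all
coefficients of all entries. -/
def frobSq {n : ℕ} (A : Matrix (Fin n) (Fin n) (Polynomial ℝ)) : ℝ :=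
  ∑ i, ∑ j, (A i j).sum fun _ a => a ^ 2

/-- Data of the problem of approximating an `n × n` matrix polynomial `A` by one with `r` kernel
vectors `b_1, …, b_r`.

* `E` spans the admissible perturbations `ΔA = ∑ s, c_s E_s`. With the monomial matrices
  `t^k e_i e_jᵀ`, `k ≤ deg A_ij`, the coordinates `c` are the vectorization of `ΔA`; other families
  give support preserving perturbations and general linear structures.
* `cols j` are the unknown coefficients of `b_j` (entry and exponent); the remaining ones are
  known to vanish and are removed.
* `rows j` are the scalar equations of the system `(A + ΔA) b_j = 0` that are kept (entry and
  exponent); the other ones, trivial or redundant, are removed.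
* `nrm j` is the normalization map, which gives the equation `nrm j b_j ⬝ b_j = 1`; a constant map
  fixes a pivot, the identity map asks for unit Euclidean norm. -/
structure LowRankProblem (n r m : ℕ) where
  A : Matrix (Fin n) (Fin n) (Polynomial ℝ)
  E : Fin m → Matrix (Fin n) (Fin n) (Polynomial ℝ)
  cols : Fin r → Finset (Fin n × ℕ)
  rows : Fin r → Finset (Fin n × ℕ)
  nrm : ∀ j, (cols j → ℝ) → (cols j → ℝ)

namespace LowRankProblem

variable {n r m : ℕ} (P : LowRankProblem n r m)

/-- Indices of the unknowns `x`: the coordinates of `ΔA`, then the coefficients of the `b_j`. -/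
abbrev Var : Type := Fin m ⊕ (Σ j : Fin r, P.cols j)

/-- Indices of the constraints: the equations kept from `(A + ΔA) b_j = 0`, then the
normalizations. -/
abbrev Con : Type := (Σ j : Fin r, P.rows j) ⊕ Fin r

/-- The perturbation `ΔA` encoded in `x`. -/
def deltaA (x : P.Var → ℝ) : Matrix (Fin n) (Fin n) (Polynomial ℝ) :=
  ∑ s, (x (Sum.inl s)) • P.E s

/-- The vector of unknown coefficients of the kernel vector `b_j` encoded in `x`. -/
def kerVec (x : P.Var → ℝ) (j : Fin r) : P.cols j → ℝ := fun s => x (Sum.inr ⟨j, s⟩)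

/-- The `j`-th diagonal block: the real embedding of `A + ΔA` restricted to the kept equations
and to the unknown coefficients of `b_j`. -/
def block (x : P.Var → ℝ) (j : Fin r) : Matrix (P.rows j) (P.cols j) ℝ :=
  (realEmbedding (P.A + P.deltaA x)).submatrix Subtype.val Subtype.val

/-- The residuals of the system of constraints. -/
def residual (x : P.Var → ℝ) : P.Con → ℝ :=
  Sum.elim (fun q => (P.block x q.1 *ᵥ P.kerVec x q.1) q.2)
    (fun j => P.nrm j (P.kerVec x j) ⬝ᵥ P.kerVec x j - 1)

/-- The Lagrangian `L(x, y) = ‖ΔA‖_F² + yᵀ M(x)`, with multipliers `y`. -/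
def lagrangian (x : P.Var → ℝ) (y : P.Con → ℝ) : ℝ :=
  frobSq (P.deltaA x) + y ⬝ᵥ P.residual x

/-- The full gradient of the Lagrangian, in the unknowns and in the multipliers. -/
def gradL (w : (P.Var → ℝ) × (P.Con → ℝ)) : P.Var ⊕ P.Con → ℝ :=
  Sum.elim (gradVec (fun x => P.lagrangian x w.2) w.1)
    (gradVec (fun y => P.lagrangian w.1 y) w.2)

/-- The Hessian of the Lagrangian with respect to the unknowns. -/
def hessL (w : (P.Var → ℝ) × (P.Con → ℝ)) : Matrix P.Var P.Var ℝ :=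
  hessMat (fun x => P.lagrangian x w.2) w.1

/-- The Jacobian of the residuals. -/
def jac (x : P.Var → ℝ) : Matrix P.Con P.Var ℝ := jacMat P.residual x

/-- The second-order sufficiency conditions at `(x, y)`: the full gradient of the Lagrangian
vanishes and its Hessian in `x` is positive definite on the kernel of the Jacobian. -/
def SecondOrderSufficient (w : (P.Var → ℝ) × (P.Con → ℝ)) : Prop :=
  P.gradL w = 0 ∧ ∀ u : P.Var → ℝ, u ≠ 0 → P.jac w.1 *ᵥ u = 0 → 0 < u ⬝ᵥ (P.hessL w *ᵥ u)

/-- The regularized matrix `[[∇²_xx L, Jᵀ], [J, -μ I]]` with `μ = ‖∇L‖₁`. -/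
def regMatrix (w : (P.Var → ℝ) × (P.Con → ℝ)) : Matrix (P.Var ⊕ P.Con) (P.Var ⊕ P.Con) ℝ :=
  Matrix.fromBlocks (P.hessL w) (P.jac w.1)ᵀ (P.jac w.1)
    (-(l1Norm (P.gradL w) • (1 : Matrix P.Con P.Con ℝ)))

/-- One step `w ↦ w'` of the regularized Newton iteration: the increment solves the regularized
system. The iteration stays at a point where the gradient already vanishes (there `μ = 0`, and the
system may be singular, with the zero increment among its solutions). -/
def IsStep (w w' : (P.Var → ℝ) × (P.Con → ℝ)) : Prop :=
  P.regMatrix w *ᵥ Sum.elim (w'.1 - w.1) (w'.2 - w.2) = -P.gradL w ∧ (P.gradL w = 0 → w' = w)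

/-- `w` is a run of the regularized Newton iteration started at `w₀`. -/
def IsRun (w₀ : (P.Var → ℝ) × (P.Con → ℝ)) (w : ℕ → (P.Var → ℝ) × (P.Con → ℝ)) : Prop :=
  w 0 = w₀ ∧ ∀ k, P.IsStep (w k) (w (k + 1))

end LowRankProblem

end

/-!
The problem is an equality constrained program: minimize `f` subject to `M = 0`, with `f` and `M` of
class `C³`; its Lagrangian is `f + yᵀ M`. Let `F = ∇L`, a `C²` map whose derivative is
`D = [[H, Jᵀ], [J, 0]]`. The Jacobian `J` may be rank deficient at the solution, so `D` may be
singular there and the multiplier need not be unique. Three facts replace its invertibility.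

* Error bound. The second-order condition makes the kernel of `D(x⋆, λ⋆)` equal to `0 × ker Jᵀ`, and
  `F` vanishes on all of `(x⋆, λ⋆) + 0 × ker Jᵀ`. Hence near the solution the distance to this affine
  space is `O(‖F‖)` (`HasStrictFDerivAt.eventually_exists_norm_sub_le`).
* Regularization. By Finsler's lemma and compactness, `H + t JᵀJ` is uniformly positive definite near
  the solution for some `t` (`exists_eventually_norm_sq_le_hess_add_jac`). So for small `μ` the
  regularized matrix has an inverse of norm `O(1/μ)` (`exists_regularized_saddle_bound`).
* Taylor's formula. With `μ` comparable to `‖F w‖` and `z` a zero of `F` at distance `O(μ)` from `w`,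
  the regularized system for `w' - z` has a right-hand side `O(μ²)`, so `w' - z = O(μ)`. Thus a step
  is `O(‖F w‖)` long, and the residual after it, which is the regularization term up to second order,
  is `O(‖F w‖²)` (`exists_regularizedNewton_step_bound`).

The step estimate alone gives quadratic convergence to a zero of `F` near the solution
(`exists_quadraticallyConverges_of_step_bound`), and by the error bound the first component of that
zero is `x⋆`.
-/

noncomputable section

open Filter Topology

/-! ### Taylor remainder and local error bound -/

section Abstract

variable {W V : Type*} [NormedAddCommGroup W] [NormedSpace ℝ W] [NormedAddCommGroup V]
  [NormedSpace ℝ V]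

theorem exists_norm_sub_sub_fderiv_le_sq {F : W → V} (hF : ContDiff ℝ 2 F) (ws : W) :
    ∃ K > 0, ∃ r > 0, ∀ x ∈ Metric.ball ws r, ∀ y ∈ Metric.ball ws r,
      ‖F y - F x - fderiv ℝ F x (y - x)‖ ≤ K * ‖y - x‖ ^ 2 := by
  have h1 : ContDiff ℝ 1 (fderiv ℝ F) := hF.fderiv_right (by norm_num)
  obtain ⟨K, t, ht, hK⟩ := h1.contDiffAt.exists_lipschitzOnWith (x := ws)
  obtain ⟨r, hr, hrt⟩ := Metric.mem_nhds_iff.1 ht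
  refine ⟨K + 1, by positivity, r, hr, fun x hx y hy => ?_⟩
  have hseg : segment ℝ x y ⊆ Metric.ball ws r := (convex_ball ws r).segment_subset hx hy
  have := (convex_segment (𝕜 := ℝ) x y).norm_image_sub_le_of_norm_hasFDerivWithin_le'
    (f := F) (f' := fderiv ℝ F) (φ := fderiv ℝ F x) (C := K * ‖y - x‖)
    (fun z _ => ((hF.differentiable (by norm_num)) z).hasFDerivAt.hasFDerivWithinAt)
    (fun z hz => ?_) (left_mem_segment ℝ x y) (right_mem_segment ℝ x y)
  · refine this.trans ?_
    nlinarith [sq_nonneg ‖y - x‖]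
  · have h2 := hK.dist_le_mul z (hrt (hseg hz)) x (hrt hx)
    rw [dist_eq_norm, dist_eq_norm] at h2
    exact h2.trans (mul_le_mul_of_nonneg_left (norm_sub_le_of_mem_segment hz) K.2)

/-- Every linear map `A` over a field has a generalized inverse `B`, that is, `A B A = A`. Then
`v - B (A v)` lies in the kernel of `A`, which needs neither an inner product nor a choice of
complement to be named. -/
theorem LinearMap.exists_generalizedInverse {k E G : Type*} [Field k] [AddCommGroup E] [Module k E]
    [AddCommGroup G] [Module k G] (A : E →ₗ[k] G) : ∃ B : G →ₗ[k] E, ∀ v, A (B (A v)) = A v := by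
  obtain ⟨g, hg⟩ := A.rangeRestrict.exists_rightInverse_of_surjective A.range_rangeRestrict
  obtain ⟨B, hB⟩ := LinearMap.exists_extend g
  refine ⟨B, fun v => ?_⟩
  have h1 : B (A v) = g (A.rangeRestrict v) := by
    rw [← hB]; rfl
  have h2 := LinearMap.congr_fun hg (A.rangeRestrict v)
  rw [h1]
  exact congrArg Subtype.val h2

/-- Local error bound: if the zero set of `F` contains the whole affine space `ws + ker A`,
`A = F'(ws)`, then close to `ws` the distance to this affine space is at most a multiple of
`‖F w‖`. The point of the affine space compared with `w = ws + v` is `ws + (v - B (A v))`, with `B`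
a generalized inverse of `A`; the difference `B (A v)` of the two is controlled by `A v`, and `A v`
is `F w - F (ws + z)` up to a small multiple of that same difference. -/
theorem HasStrictFDerivAt.eventually_exists_norm_sub_le [FiniteDimensional ℝ W]
    [FiniteDimensional ℝ V] {F : W → V} {A : W →L[ℝ] V} {ws : W}
    (hF : HasStrictFDerivAt F A ws) (hker : ∀ z, A z = 0 → F (ws + z) = 0) :
    ∃ C > 0, ∀ᶠ w in 𝓝 ws, ∃ z, A z = 0 ∧ ‖w - (ws + z)‖ ≤ C * ‖F w‖ := by
  obtain ⟨B₀, hB₀⟩ := A.toLinearMap.exists_generalizedInverse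
  set B : V →L[ℝ] W := LinearMap.toContinuousLinearMap B₀ with hBdef
  have hB : ∀ v, A (B (A v)) = A v := hB₀
  set b : ℝ := ‖B‖ + 1 with hb
  have hbpos : 0 < b := by positivity
  have hlo := hF.isLittleO.def (c := 1 / (2 * b)) (by positivity)
  have hc : Tendsto (fun w : W => (w, ws + ((w - ws) - B (A (w - ws))))) (𝓝 ws)
      (𝓝 (ws, ws)) := by
    have : Continuous (fun w : W => (w, ws + ((w - ws) - B (A (w - ws))))) := by fun_prop
    simpa using this.tendsto ws
  refine ⟨2 * b, by positivity, (hc.eventually hlo).mono fun w hw =>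
    ⟨(w - ws) - B (A (w - ws)), ?_, ?_⟩⟩
  · rw [map_sub, hB, sub_self]
  · have hz : A ((w - ws) - B (A (w - ws))) = 0 := by rw [map_sub, hB, sub_self]
    have e : w - (ws + ((w - ws) - B (A (w - ws)))) = B (A (w - ws)) := by abel
    simp only [hker _ hz, sub_zero, e, hB] at hw
    rw [e]
    have h1 : ‖B (A (w - ws))‖ ≤ b * ‖A (w - ws)‖ :=
      (B.le_opNorm _).trans (by gcongr; linarith)
    have h2 : ‖A (w - ws)‖ ≤ ‖F w‖ + ‖F w - A (w - ws)‖ := by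
      have := norm_sub_le (F w) (F w - A (w - ws))
      simpa using this
    have h3 : 1 / (2 * b) * ‖B (A (w - ws))‖ ≤ 1 / 2 * ‖A (w - ws)‖ := by
      calc _ ≤ 1 / (2 * b) * (b * ‖A (w - ws)‖) := by gcongr
        _ = _ := by field_simp
    have h4 : ‖A (w - ws)‖ ≤ 2 * ‖F w‖ := by linarith
    calc _ ≤ b * ‖A (w - ws)‖ := h1
      _ ≤ b * (2 * ‖F w‖) := by gcongr
      _ = _ := by ring

/-! ### One step of the regularized Newton iteration -/

/-- The regularized Newton step `(F'(w) - μ T) d = -F w`, with `μ` comparable to `‖F w‖`, exists, is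
unique, has length `O(‖F w‖)` and makes the new residual `O(‖F w‖²)`. The derivative may be singular
at `ws`: all that is asked of `F'(w) - μ T` is an inverse of norm `O(1/μ)`. The division by `μ` is
affordable because, measured from the nearby zero `z` of `F`, the right-hand side is `O(‖F w‖²)`.
-/
theorem exists_regularizedNewton_step_bound [FiniteDimensional ℝ W] [FiniteDimensional ℝ V]
    (hdim : Module.finrank ℝ W = Module.finrank ℝ V)
    {F : W → V} (hF : ContDiff ℝ 2 F) {ws : W} (hws : F ws = 0) (T : W →L[ℝ] V) {μ : W → ℝ}
    {C₀ : ℝ} (hC₀ : 0 < C₀) (hμ : ∀ w, ‖F w‖ ≤ μ w) (hμ' : ∀ w, μ w ≤ C₀ * ‖F w‖)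
    {C₁ : ℝ} (hC₁ : 0 < C₁)
    (herr : ∀ᶠ w in 𝓝 ws, ∃ z, F z = 0 ∧ ‖w - z‖ ≤ C₁ * ‖F w‖)
    {C₂ : ℝ} (hC₂ : 0 < C₂) {μ₀ : ℝ} (hμ₀ : 0 < μ₀)
    (hinv : ∀ᶠ w in 𝓝 ws, ∀ t : ℝ, 0 < t → t < μ₀ → ∀ v,
      t * ‖v‖ ≤ C₂ * ‖fderiv ℝ F w v - t • T v‖)
    {Step : W → W → Prop} (hStep : ∀ w w', Step w w' ↔
      fderiv ℝ F w (w' - w) - μ w • T (w' - w) = - F w ∧ (F w = 0 → w' = w)) :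
    ∃ C > 0, ∀ᶠ w in 𝓝 ws, (∃! w', Step w w') ∧
      ∀ w', Step w w' → ‖w' - w‖ ≤ C * ‖F w‖ ∧ ‖F w'‖ ≤ C * ‖F w‖ ^ 2 := by
  obtain ⟨K, hK, r, hr, hT⟩ := exists_norm_sub_sub_fderiv_le_sq hF ws
  set C₃ : ℝ := C₂ * (K * C₁ ^ 2 + C₀ * ‖T‖ * C₁) with hC₃
  have hC₃0 : 0 ≤ C₃ := by positivity
  set C₄ : ℝ := C₃ + C₁ with hC₄
  have hC₄0 : 0 < C₄ := by positivity
  set C₅ : ℝ := C₀ * ‖T‖ * C₄ + K * C₄ ^ 2 with hC₅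
  have hC₅0 : 0 < C₅ := by positivity
  have hF0 : Tendsto (fun w => ‖F w‖) (𝓝 ws) (𝓝 0) := by
    simpa [hws] using (hF.continuous.norm.tendsto ws)
  have hs : ∀ ε : ℝ, 0 < ε → ∀ᶠ w in 𝓝 ws, ‖F w‖ < ε := fun ε hε =>
    hF0.eventually (gt_mem_nhds hε)
  refine ⟨C₄ + C₅, by positivity, ?_⟩
  filter_upwards [herr, hinv, Metric.ball_mem_nhds ws (half_pos hr),
    hs (μ₀ / C₀) (by positivity), hs (r / 2 / C₁) (by positivity),
    hs (r / 2 / C₄) (by positivity)] with w ⟨z, hz, hwz⟩ hinv hwr hm0 hm1 hm2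
  rw [lt_div_iff₀ (by positivity), mul_comm] at hm0 hm1 hm2
  rcases eq_or_ne (F w) 0 with h0 | h0
  · refine ⟨⟨w, (hStep _ _).2 ⟨by simp [h0], fun _ => rfl⟩,
      fun w' h => ((hStep _ _).1 h).2 h0⟩, fun w' h => ?_⟩
    have := ((hStep _ _).1 h).2 h0
    subst this
    simp [h0]
  have hmpos : 0 < ‖F w‖ := norm_pos_iff.2 h0
  have hμpos : 0 < μ w := hmpos.trans_le (hμ w)
  -- away from the zeros of `F` the regularized derivative is invertible
  have hinv := hinv (μ w) hμpos ((hμ' w).trans_lt hm0)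
  set L : W →ₗ[ℝ] V := (fderiv ℝ F w - μ w • T).toLinearMap with hL
  have hLv : ∀ v, L v = fderiv ℝ F w v - μ w • T v := fun v => rfl
  have hinj : Function.Injective L := by
    rw [injective_iff_map_eq_zero]
    intro v hv
    have := hinv v
    rw [← hLv, hv, norm_zero, mul_zero] at this
    exact norm_le_zero_iff.1 (nonpos_of_mul_nonpos_right this hμpos)
  have hsurj : Function.Surjective L :=
    (LinearMap.injective_iff_surjective_of_finrank_eq_finrank hdim).1 hinj
  have hiff : ∀ w', Step w w' ↔ L (w' - w) = - F w := fun w' => by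
    rw [hStep, hLv]
    exact ⟨fun h => h.1, fun h => ⟨h, fun h' => absurd h' h0⟩⟩
  have hwr' : w ∈ Metric.ball ws r := Metric.ball_subset_ball (by linarith) hwr
  rw [mem_ball_iff_norm] at hwr
  refine ⟨?_, fun w' h => ?_⟩
  · obtain ⟨d, hd⟩ := hsurj (- F w)
    refine ⟨w + d, (hiff _).2 (by simpa using hd), fun w' h => ?_⟩
    have := hinj (((hiff w').1 h).trans hd.symm)
    rw [← this]; abel
  have hzr : z ∈ Metric.ball ws r := by
    rw [mem_ball_iff_norm]
    have e : z - ws = (w - ws) - (w - z) := by abel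
    rw [e]
    linarith [norm_sub_le (w - ws) (w - z)]
  have hd := (hiff w').1 h
  -- `w' - z` solves the regularized system with a right-hand side of second order: the Taylor
  -- remainder between `z` and `w`, and the regularization applied to `w - z`
  have hres : ‖L (w' - z)‖ ≤ (K * C₁ ^ 2 + C₀ * ‖T‖ * C₁) * ‖F w‖ ^ 2 := by
    have e : L (w' - z) = (F z - F w - fderiv ℝ F w (z - w)) - μ w • T (w - z) := by
      have e1 : w' - z = (w' - w) + (w - z) := by abel
      have e2 : z - w = - (w - z) := by abel
      rw [e1, map_add, hd, hLv, hz, e2, map_neg]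
      abel
    rw [e]
    have h1 := hT w hwr' z hzr
    rw [norm_sub_rev z w] at h1
    have h2 : ‖μ w • T (w - z)‖ ≤ (C₀ * ‖F w‖) * (‖T‖ * (C₁ * ‖F w‖)) := by
      rw [norm_smul, Real.norm_of_nonneg hμpos.le]
      gcongr
      · exact hμ' w
      · exact (T.le_opNorm _).trans (by gcongr)
    have h3 : K * ‖w - z‖ ^ 2 ≤ K * (C₁ * ‖F w‖) ^ 2 := by gcongr
    refine (norm_sub_le _ _).trans ?_
    nlinarith
  have hv : ‖w' - z‖ ≤ C₃ * ‖F w‖ := by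
    have h1 := hinv (w' - z)
    rw [← hLv] at h1
    have h2 : ‖F w‖ * ‖w' - z‖ ≤ ‖F w‖ * (C₃ * ‖F w‖) := by
      calc _ ≤ μ w * ‖w' - z‖ := by gcongr; exact hμ w
        _ ≤ _ := h1
        _ ≤ C₂ * ((K * C₁ ^ 2 + C₀ * ‖T‖ * C₁) * ‖F w‖ ^ 2) := by gcongr
        _ = _ := by rw [hC₃]; ring
    exact le_of_mul_le_mul_left h2 hmpos
  have hstep : ‖w' - w‖ ≤ C₄ * ‖F w‖ := by
    have e : w' - w = (w' - z) - (w - z) := by abel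
    rw [e, hC₄, add_mul]
    exact (norm_sub_le _ _).trans (add_le_add hv hwz)
  have hw'r : w' ∈ Metric.ball ws r := by
    rw [mem_ball_iff_norm]
    have e : w' - ws = (w' - w) + (w - ws) := by abel
    rw [e]
    linarith [norm_add_le (w' - w) (w - ws)]
  have hFw' : ‖F w'‖ ≤ C₅ * ‖F w‖ ^ 2 := by
    -- the linearized residual after the step is exactly the regularization term
    have e : F w' = (F w' - F w - fderiv ℝ F w (w' - w)) + μ w • T (w' - w) := by
      have : fderiv ℝ F w (w' - w) = - F w + μ w • T (w' - w) := by
        rw [← hd, hLv]; abel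
      rw [this]; abel
    rw [e]
    have h1 := hT w hwr' w' hw'r
    have h2 : ‖μ w • T (w' - w)‖ ≤ (C₀ * ‖F w‖) * (‖T‖ * (C₄ * ‖F w‖)) := by
      rw [norm_smul, Real.norm_of_nonneg hμpos.le]
      gcongr
      · exact hμ' w
      · exact (T.le_opNorm _).trans (by gcongr)
    have h3 : K * ‖w' - w‖ ^ 2 ≤ K * (C₄ * ‖F w‖) ^ 2 := by gcongr
    refine (norm_add_le _ _).trans ?_
    rw [hC₅]
    nlinarith
  exact ⟨hstep.trans (by gcongr; linarith), hFw'.trans (by gcongr; linarith)⟩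

/-! ### From a step estimate to quadratic convergence -/

/-- A relation which has exactly one successor at every point satisfying an invariant `Good k`, and
which preserves the invariant, has exactly one run from a good initial point. -/
theorem existsUnique_run_of_existsUnique_step {X : Type*} {Step : X → X → Prop} {x₀ : X}
    {Good : ℕ → X → Prop} (h0 : Good 0 x₀) (hex : ∀ k x, Good k x → ∃! x', Step x x')
    (hgood : ∀ k x x', Good k x → Step x x' → Good (k + 1) x') :
    ∃! w : ℕ → X, w 0 = x₀ ∧ ∀ k, Step (w k) (w (k + 1)) := by
  classical
  let next : X → X := fun x => if h : ∃ x', Step x x' then h.choose else x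
  have hnext : ∀ k x, Good k x → Step x (next x) := fun k x hx => by
    have h : ∃ x', Step x x' := (hex k x hx).exists
    simp only [next, dif_pos h]
    exact h.choose_spec
  let w : ℕ → X := fun k => next^[k] x₀
  have hw : ∀ k, w (k + 1) = next (w k) := fun k => Function.iterate_succ_apply' next k x₀
  have hg : ∀ k, Good k (w k) := by
    intro k
    induction k with
    | zero => exact h0
    | succ k ih => rw [hw]; exact hgood k _ _ ih (hnext k _ ih)
  refine ⟨w, ⟨rfl, fun k => hw k ▸ hnext k _ (hg k)⟩, fun v hv => funext fun k => ?_⟩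
  induction k with
  | zero => exact hv.1
  | succ k ih =>
    refine (hex k _ (hg k)).unique (ih ▸ hv.2 k) ?_
    exact hw k ▸ hnext k _ (hg k)

/-- If every step is `O(‖F w‖)` long and leaves a residual `O(‖F w‖²)`, then runs started close to a
zero `ws` of `F` converge quadratically to some zero `wh` of `F`, in any prescribed neighborhood
`U` of `ws`. The residuals decrease at least geometrically, so the remaining path from `w k` is
`O(‖F (w k)‖)`; conversely `‖F (w k)‖ = O(‖w k - wh‖)`, as `F` is locally Lipschitz. -/
theorem exists_quadraticallyConverges_of_step_bound [CompleteSpace W] {F : W → V}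
    (hF : ContDiff ℝ 1 F) {ws : W} (hws : F ws = 0) {Step : W → W → Prop} {C : ℝ} (hC : 0 < C)
    (hstep : ∀ᶠ w in 𝓝 ws, (∃! w', Step w w') ∧
      ∀ w', Step w w' → ‖w' - w‖ ≤ C * ‖F w‖ ∧ ‖F w'‖ ≤ C * ‖F w‖ ^ 2)
    {U : Set W} (hU : U ∈ 𝓝 ws) :
    ∃ ρ > 0, ∃ C' > 0, ∀ w₀ : W, ‖w₀ - ws‖ < ρ →
      (∃! w : ℕ → W, w 0 = w₀ ∧ ∀ k, Step (w k) (w (k + 1))) ∧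
      ∀ w : ℕ → W, (w 0 = w₀ ∧ ∀ k, Step (w k) (w (k + 1))) →
        ∃ wh ∈ U, F wh = 0 ∧ ‖wh - ws‖ ≤ C' * ‖w₀ - ws‖ ∧ QuadraticallyConverges w wh C' := by
  obtain ⟨K, t, ht, hK⟩ := hF.contDiffAt.exists_lipschitzOnWith (x := ws)
  obtain ⟨r, hr, hrt⟩ := Metric.mem_nhds_iff.1 (inter_mem (inter_mem hstep ht) hU)
  set k₀ : ℝ := (K : ℝ)
  have hk₀0 : 0 ≤ k₀ := K.2
  have hLip : ∀ x ∈ Metric.ball ws r, ∀ y ∈ Metric.ball ws r, F y = 0 →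
      ‖F x‖ ≤ k₀ * ‖x - y‖ := fun x hx y hy h => by
    have := hK.dist_le_mul x (hrt hx).1.2 y (hrt hy).1.2
    rwa [dist_eq_norm, dist_eq_norm, h, sub_zero] at this
  have hst : ∀ x ∈ Metric.ball ws r, (∃! w', Step x w') ∧
      ∀ w', Step x w' → ‖w' - x‖ ≤ C * ‖F x‖ ∧ ‖F w'‖ ≤ C * ‖F x‖ ^ 2 :=
    fun x hx => (hrt hx).1.1
  set c : ℝ := 1 + 2 * C * k₀ with hc
  have hc0 : 1 ≤ c := by rw [hc]; nlinarith [mul_nonneg hC.le hk₀0]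
  set C' : ℝ := c + 2 * C ^ 2 * k₀ ^ 2 with hC'
  refine ⟨min (r / c) (1 / (2 * C * (k₀ + 1))), by positivity, C', by positivity,
    fun w₀ hw₀ => ?_⟩
  obtain ⟨hρ1, hρ2⟩ := lt_min_iff.1 hw₀
  rw [lt_div_iff₀ (by positivity)] at hρ1 hρ2
  have hw₀r : w₀ ∈ Metric.ball ws r := by
    rw [mem_ball_iff_norm]; nlinarith [norm_nonneg (w₀ - ws)]
  have hF₀ : ‖F w₀‖ ≤ k₀ * ‖w₀ - ws‖ := hLip w₀ hw₀r ws (Metric.mem_ball_self hr) hws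
  have hCF : C * ‖F w₀‖ ≤ 1 / 2 := by
    have : C * ‖F w₀‖ ≤ C * (k₀ * ‖w₀ - ws‖) := by gcongr
    nlinarith [mul_nonneg hC.le (norm_nonneg (w₀ - ws))]
  -- after `k` steps the residual has shrunk by `2⁻ᵏ`, and the path so far is bounded by the
  -- partial sum of the corresponding geometric series
  let Good : ℕ → W → Prop := fun k x =>
    ‖F x‖ ≤ ‖F w₀‖ * (1 / 2) ^ k ∧ ‖x - w₀‖ ≤ 2 * C * ‖F w₀‖ * (1 - (1 / 2) ^ k)
  have hball : ∀ x, ‖x - w₀‖ ≤ 2 * C * ‖F w₀‖ → ‖x - ws‖ ≤ c * ‖w₀ - ws‖ := fun x hx => by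
    have e : x - ws = (x - w₀) + (w₀ - ws) := by abel
    have h1 : 2 * C * ‖F w₀‖ ≤ 2 * C * (k₀ * ‖w₀ - ws‖) := by gcongr
    rw [e]
    refine (norm_add_le _ _).trans ?_
    rw [hc]; linarith
  have hgr : ∀ k x, Good k x → x ∈ Metric.ball ws r := fun k x hx => by
    rw [mem_ball_iff_norm]
    have hp : (0 : ℝ) ≤ (1 / 2) ^ k := by positivity
    have := hball x (hx.2.trans (by nlinarith [mul_nonneg hC.le (norm_nonneg (F w₀))]))
    linarith
  have hgood : ∀ k x x', Good k x → Step x x' → Good (k + 1) x' := by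
    intro k x x' hx h
    obtain ⟨h1, h2⟩ := (hst x (hgr k x hx)).2 x' h
    have hp : (0 : ℝ) ≤ (1 / 2) ^ k := by positivity
    have hp1 : ((1 : ℝ) / 2) ^ k ≤ 1 := pow_le_one₀ (by norm_num) (by norm_num)
    have hFx : C * ‖F x‖ ≤ 1 / 2 := by
      have : C * ‖F x‖ ≤ C * (‖F w₀‖ * (1 / 2) ^ k) := by gcongr; exact hx.1
      nlinarith [mul_nonneg hC.le (norm_nonneg (F w₀))]
    constructor
    · have : C * ‖F x‖ ^ 2 ≤ 1 / 2 * ‖F x‖ := by nlinarith [norm_nonneg (F x)]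
      rw [pow_succ]
      linarith [hx.1]
    · have e : x' - w₀ = (x' - x) + (x - w₀) := by abel
      have h3 : C * ‖F x‖ ≤ C * (‖F w₀‖ * (1 / 2) ^ k) := by gcongr; exact hx.1
      rw [e]
      refine (norm_add_le _ _).trans ?_
      rw [pow_succ]
      linarith [hx.2]
  have hg0 : Good 0 w₀ := by simp [Good]
  refine ⟨existsUnique_run_of_existsUnique_step hg0 (fun k x hx => (hst x (hgr k x hx)).1) hgood,
    fun w hw => ?_⟩
  have hg : ∀ k, Good k (w k) := by
    intro k
    induction k with
    | zero => rw [hw.1]; exact hg0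
    | succ k ih => exact hgood k _ _ ih (hw.2 k)
  have hb : ∀ k, w k ∈ Metric.ball ws r := fun k => hgr k _ (hg k)
  have hs1 : ∀ k, ‖w (k + 1) - w k‖ ≤ C * ‖F (w k)‖ := fun k =>
    ((hst _ (hb k)).2 _ (hw.2 k)).1
  have hs2 : ∀ k, ‖F (w (k + 1))‖ ≤ C * ‖F (w k)‖ ^ 2 := fun k =>
    ((hst _ (hb k)).2 _ (hw.2 k)).2
  have hCFk : ∀ k, C * ‖F (w k)‖ ≤ 1 / 2 := fun k => by
    have hp1 : ((1 : ℝ) / 2) ^ k ≤ 1 := pow_le_one₀ (by norm_num) (by norm_num)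
    have : C * ‖F (w k)‖ ≤ C * (‖F w₀‖ * (1 / 2) ^ k) := by gcongr; exact (hg k).1
    nlinarith [mul_nonneg hC.le (norm_nonneg (F w₀))]
  have hdec : ∀ k i, ‖F (w (k + i))‖ ≤ ‖F (w k)‖ / 2 ^ i := by
    intro k i
    induction i with
    | zero => simp
    | succ i ih =>
      have h1 := hs2 (k + i)
      have h2 := hCFk (k + i)
      rw [← add_assoc, pow_succ, ← div_div]
      nlinarith [norm_nonneg (F (w (k + i)))]
  have hgeo : ∀ k i, dist (w (k + i)) (w (k + (i + 1))) ≤ (2 * C * ‖F (w k)‖) / 2 / 2 ^ i := by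
    intro k i
    rw [dist_comm, dist_eq_norm, ← add_assoc]
    calc _ ≤ C * ‖F (w (k + i))‖ := hs1 _
      _ ≤ C * (‖F (w k)‖ / 2 ^ i) := by gcongr; exact hdec k i
      _ = _ := by ring
  have hcau : CauchySeq w := cauchySeq_of_le_geometric_two (C := 2 * C * ‖F (w 0)‖)
    (fun i => by simpa using hgeo 0 i)
  obtain ⟨wh, hwh⟩ := cauchySeq_tendsto_of_complete hcau
  have hdist : ∀ k, ‖w k - wh‖ ≤ 2 * C * ‖F (w k)‖ := fun k => by
    rw [← dist_eq_norm]
    exact dist_le_of_le_geometric_two_of_tendsto₀ (f := fun i => w (k + i)) (hgeo k)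
      (hwh.comp (tendsto_add_atTop_nat k) |>.congr fun i => by simp [add_comm])
  have hwhd : ‖wh - ws‖ ≤ c * ‖w₀ - ws‖ := hball wh (by
    have := hdist 0
    rwa [hw.1, norm_sub_rev] at this)
  have hwhr : wh ∈ Metric.ball ws r := by rw [mem_ball_iff_norm]; linarith
  have hFwh : F wh = 0 := by
    have h1 : Tendsto (fun k => ‖F (w k)‖) atTop (𝓝 ‖F wh‖) :=
      ((hF.continuous.tendsto wh).comp hwh).norm
    have h2 : Tendsto (fun k : ℕ => ‖F w₀‖ * (1 / 2) ^ k) atTop (𝓝 (‖F w₀‖ * 0)) :=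
      (tendsto_pow_atTop_nhds_zero_of_lt_one (by norm_num) (by norm_num)).const_mul _
    have h3 := le_of_tendsto_of_tendsto' h1 h2 fun k => (hg k).1
    rw [mul_zero] at h3
    exact norm_le_zero_iff.1 h3
  refine ⟨wh, (hrt hwhr).2, hFwh, hwhd.trans ?_, hwh, fun k => ?_⟩
  · gcongr
    rw [hC']; nlinarith [sq_nonneg (C * k₀)]
  · have h1 : ‖F (w k)‖ ≤ k₀ * ‖w k - wh‖ := hLip _ (hb k) _ hwhr hFwh
    calc ‖w (k + 1) - wh‖ ≤ 2 * C * ‖F (w (k + 1))‖ := hdist _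
      _ ≤ 2 * C * (C * ‖F (w k)‖ ^ 2) := by gcongr; exact hs2 k
      _ ≤ 2 * C * (C * (k₀ * ‖w k - wh‖) ^ 2) := by gcongr
      _ = 2 * C ^ 2 * k₀ ^ 2 * ‖w k - wh‖ ^ 2 := by ring
      _ ≤ C' * ‖w k - wh‖ ^ 2 := by gcongr; rw [hC']; linarith

end Abstract

/-! ### The regularized saddle point system -/

section Norms

variable {σ : Type*} [Fintype σ]

theorem norm_le_l1Norm (v : σ → ℝ) : ‖v‖ ≤ l1Norm v := by
  refine (pi_norm_le_iff_of_nonneg (Finset.sum_nonneg fun i _ => abs_nonneg _)).2 fun i => ?_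
  exact Finset.single_le_sum (f := fun i => |v i|) (fun i _ => abs_nonneg _) (Finset.mem_univ i)

theorem l1Norm_le_card_mul_norm (v : σ → ℝ) : l1Norm v ≤ Fintype.card σ * ‖v‖ := by
  have := Finset.sum_le_card_nsmul Finset.univ (fun i => |v i|) ‖v‖ fun i _ => norm_le_pi_norm v i
  simpa [l1Norm] using this

theorem dotProduct_self_le_card_mul_norm_sq (v : σ → ℝ) : v ⬝ᵥ v ≤ Fintype.card σ * ‖v‖ ^ 2 := by
  have := Finset.sum_le_card_nsmul Finset.univ (fun i => v i * v i) (‖v‖ ^ 2) fun i _ => by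
    have := norm_le_pi_norm v i
    rw [← sq, ← sq_abs]
    exact pow_le_pow_left₀ (abs_nonneg _) this 2
  simpa [dotProduct] using this

theorem norm_sq_le_dotProduct_self (v : σ → ℝ) : ‖v‖ ^ 2 ≤ v ⬝ᵥ v := by
  have h0 : 0 ≤ v ⬝ᵥ v := Finset.sum_nonneg fun i _ => mul_self_nonneg _
  rw [← Real.le_sqrt (norm_nonneg _) h0, pi_norm_le_iff_of_nonneg (Real.sqrt_nonneg _)]
  intro i
  rw [Real.norm_eq_abs]
  refine Real.abs_le_sqrt ?_
  rw [sq]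
  exact Finset.single_le_sum (f := fun i => v i * v i) (fun i _ => mul_self_nonneg _)
    (Finset.mem_univ i)

theorem dotProduct_le_of_pos (u v : σ → ℝ) {s : ℝ} (hs : 0 < s) :
    u ⬝ᵥ v ≤ s * (u ⬝ᵥ u) + 1 / (4 * s) * (v ⬝ᵥ v) := by
  simp only [dotProduct, Finset.mul_sum, ← Finset.sum_add_distrib]
  refine Finset.sum_le_sum fun i _ => ?_
  have h : s * (u i * u i) + 1 / (4 * s) * (v i * v i) - u i * v i =
      s * (u i - v i / (2 * s)) ^ 2 := by field_simp; ring
  nlinarith [mul_nonneg hs.le (sq_nonneg (u i - v i / (2 * s)))]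

/-- If `H + t JᵀJ` is positive definite with modulus `c`, the inverse of `[[H, Jᵀ], [J, -μ I]]` has
norm `O(1/μ)` for small `μ`, uniformly in `H` and `J`, whatever the rank of `J`. Eliminating the
second unknown leaves `H + μ⁻¹ JᵀJ`, and `μ⁻¹` exceeds `t`. -/
theorem exists_regularized_saddle_bound {σ τ : Type*} [Fintype σ] [Fintype τ] {c t : ℝ}
    (hc : 0 < c) (ht : 0 < t) :
    ∃ C > 0, ∃ μ₀ > 0, ∀ (H : Matrix σ σ ℝ) (J : Matrix τ σ ℝ),
      (∀ u, c * ‖u‖ ^ 2 ≤ u ⬝ᵥ (H *ᵥ u) + t * (J *ᵥ u ⬝ᵥ J *ᵥ u)) →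
      ∀ μ : ℝ, 0 < μ → μ < μ₀ → ∀ p q,
        μ * ‖((p, q) : (σ → ℝ) × (τ → ℝ))‖ ≤
          C * ‖(Sum.elim (H *ᵥ p + Jᵀ *ᵥ q) (J *ᵥ p - μ • q) : σ ⊕ τ → ℝ)‖ := by
  set s : ℝ := c / (2 * (Fintype.card σ + 1)) with hs
  have hs0 : 0 < s := by positivity
  have hsc : s * Fintype.card σ ≤ c / 2 := by
    rw [hs, div_mul_eq_mul_div, div_le_div_iff₀ (by positivity) (by positivity)]
    nlinarith
  set K : ℝ := 1 / (4 * s) * Fintype.card σ + Fintype.card τ with hK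
  have hK0 : 0 ≤ K := by positivity
  refine ⟨2 * K / c + 2 * K + 2, by positivity, min 1 (1 / (4 * t)), by positivity,
    fun H J hHJ μ hμ hμ₀ p q => ?_⟩
  obtain ⟨hμ1, hμt⟩ := lt_min_iff.1 hμ₀
  rw [lt_div_iff₀ (by positivity)] at hμt
  set a := H *ᵥ p + Jᵀ *ᵥ q with ha
  set b := J *ᵥ p - μ • q with hb
  set R := ‖(Sum.elim a b : σ ⊕ τ → ℝ)‖ with hR
  have hR0 : 0 ≤ R := norm_nonneg _
  have haR : ‖a‖ ≤ R := (pi_norm_le_iff_of_nonneg hR0).2 fun i =>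
    norm_le_pi_norm (Sum.elim a b : σ ⊕ τ → ℝ) (Sum.inl i)
  have hbR : ‖b‖ ≤ R := (pi_norm_le_iff_of_nonneg hR0).2 fun i =>
    norm_le_pi_norm (Sum.elim a b : σ ⊕ τ → ℝ) (Sum.inr i)
  set X := p ⬝ᵥ (H *ᵥ p) with hX
  set Y := J *ᵥ p ⬝ᵥ J *ᵥ p with hY
  have hY0 : 0 ≤ Y := Finset.sum_nonneg fun i _ => mul_self_nonneg _
  -- eliminating `q` from the two block rows
  have hpa : p ⬝ᵥ a = X + q ⬝ᵥ (J *ᵥ p) := by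
    rw [ha, dotProduct_add, Matrix.mulVec_transpose, dotProduct_comm p (q ᵥ* J),
      ← Matrix.dotProduct_mulVec]
  have hbJ : b ⬝ᵥ (J *ᵥ p) = Y - μ * (q ⬝ᵥ (J *ᵥ p)) := by
    rw [hb, sub_dotProduct, smul_dotProduct, smul_eq_mul]
  have h1 := hHJ p
  have h2 : p ⬝ᵥ a ≤ c / 2 * ‖p‖ ^ 2 + 1 / (4 * s) * (a ⬝ᵥ a) := by
    refine (dotProduct_le_of_pos p a hs0).trans (by
      have := mul_le_mul_of_nonneg_left (dotProduct_self_le_card_mul_norm_sq p) hs0.le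
      nlinarith [sq_nonneg ‖p‖])
  have h3 : b ⬝ᵥ (J *ᵥ p) ≤ b ⬝ᵥ b + 1 / 4 * Y := by
    simpa using dotProduct_le_of_pos b (J *ᵥ p) one_pos
  have haa : a ⬝ᵥ a ≤ Fintype.card σ * R ^ 2 :=
    (dotProduct_self_le_card_mul_norm_sq a).trans (by gcongr)
  have hbb : b ⬝ᵥ b ≤ Fintype.card τ * R ^ 2 :=
    (dotProduct_self_le_card_mul_norm_sq b).trans (by gcongr)
  have hmain : μ * (c / 2) * ‖p‖ ^ 2 + Y / 2 ≤ K * R ^ 2 := by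
    have h4 : μ * (1 / (4 * s) * (a ⬝ᵥ a)) ≤ 1 / (4 * s) * (Fintype.card σ * R ^ 2) := by
      calc μ * (1 / (4 * s) * (a ⬝ᵥ a)) ≤ 1 * (1 / (4 * s) * (Fintype.card σ * R ^ 2)) := by
            gcongr
            exact mul_nonneg (by positivity) (Finset.sum_nonneg fun i _ => mul_self_nonneg _)
        _ = _ := one_mul _
    have h5 := mul_le_mul_of_nonneg_left h1 hμ.le
    have h6 := mul_le_mul_of_nonneg_left h2 hμ.le
    have h7 : μ * (t * Y) ≤ 1 / 4 * Y := by
      rw [← mul_assoc]; gcongr; linarith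
    rw [hpa] at h6
    rw [hbJ] at h3
    rw [hK]
    linarith
  have hp : μ * ‖p‖ ≤ (2 * K / c + 1) * R := by
    rw [← pow_le_pow_iff_left₀ (by positivity) (by positivity) two_ne_zero]
    have h4 : μ * ‖p‖ ^ 2 ≤ 2 * K / c * R ^ 2 := by
      rw [div_mul_eq_mul_div, le_div_iff₀ hc]
      linarith
    have h5 : (0 : ℝ) ≤ 2 * K / c := by positivity
    calc (μ * ‖p‖) ^ 2 = μ * (μ * ‖p‖ ^ 2) := by ring
      _ ≤ 1 * (2 * K / c * R ^ 2) := by gcongr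
      _ = 2 * K / c * R ^ 2 := one_mul _
      _ ≤ (2 * K / c + 1) ^ 2 * R ^ 2 := by gcongr; nlinarith
      _ = _ := by ring
  have hJp : ‖J *ᵥ p‖ ≤ (2 * K + 1) * R := by
    rw [← pow_le_pow_iff_left₀ (norm_nonneg _) (by positivity) two_ne_zero]
    calc ‖J *ᵥ p‖ ^ 2 ≤ Y := norm_sq_le_dotProduct_self _
      _ ≤ 2 * K * R ^ 2 := by
        have : 0 ≤ μ * (c / 2) * ‖p‖ ^ 2 := by positivity
        linarith
      _ ≤ (2 * K + 1) ^ 2 * R ^ 2 := by gcongr; nlinarith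
      _ = _ := by ring
  have hq : μ * ‖q‖ ≤ (2 * K + 2) * R := by
    have e : μ • q = J *ᵥ p - b := by rw [hb]; abel
    calc μ * ‖q‖ = ‖μ • q‖ := by rw [norm_smul, Real.norm_of_nonneg hμ.le]
      _ ≤ ‖J *ᵥ p‖ + ‖b‖ := e ▸ norm_sub_le _ _
      _ ≤ _ := by linarith
  have h5 : (0 : ℝ) ≤ 2 * K / c * R := by positivity
  have h6 : (0 : ℝ) ≤ K * R := by positivity
  rw [Prod.norm_mk, mul_max_of_nonneg _ _ hμ.le]
  exact max_le (by linarith) (by linarith)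

end Norms

/-! ### The gradient of the Lagrangian and its derivative -/

section Coordinates

variable {σ τ : Type*} [Fintype σ] [DecidableEq σ] [Fintype τ]

theorem fderiv_apply_eq_dotProduct_gradVec (f : (σ → ℝ) → ℝ) (x p : σ → ℝ) :
    fderiv ℝ f x p = p ⬝ᵥ gradVec f x := by
  conv_lhs => rw [pi_eq_sum_univ' p]
  simp [dotProduct, gradVec, map_sum]

/-- The Hessian matrix of a `C²` function is symmetric. -/
theorem hessMat_transpose {f : (σ → ℝ) → ℝ} (hf : ContDiff ℝ 2 f) (x : σ → ℝ) :
    (hessMat f x)ᵀ = hessMat f x := by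
  have h1 : Differentiable ℝ (fderiv ℝ f) :=
    (hf.fderiv_right (m := 1) (by norm_num)).differentiable (by norm_num)
  have key : ∀ i j, hessMat f x i j =
      fderiv ℝ (fderiv ℝ f) x (Pi.single i 1) (Pi.single j 1) := fun i j => by
    have h2 := ((h1 x).hasFDerivAt.clm_apply (hasFDerivAt_const (Pi.single j (1 : ℝ)) x)).fderiv
    simp only [hessMat, Matrix.of_apply, gradVec]
    rw [h2]; simp
  ext i j
  rw [Matrix.transpose_apply, key, key]
  exact (hf.contDiffAt.isSymmSndFDerivAt (by simp)) _ _

variable {f : (σ → ℝ) → ℝ} {M : (σ → ℝ) → (τ → ℝ)}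

theorem gradVec_add_dotProduct (hf : ContDiff ℝ 3 f) (hM : ContDiff ℝ 3 M) (x : σ → ℝ)
    (y : τ → ℝ) :
    gradVec (fun x => f x + y ⬝ᵥ M x) x = gradVec f x + (jacMat M x)ᵀ *ᵥ y := by
  have hf1 : DifferentiableAt ℝ f x := hf.differentiable (by norm_num) x
  have hM1 : ∀ a, DifferentiableAt ℝ (fun x => M x a) x := fun a =>
    differentiableAt_pi.1 (hM.differentiable (by norm_num) x) a
  funext i
  have h : HasFDerivAt (fun x => f x + ∑ a, y a * M x a)
      (fderiv ℝ f x + ∑ a, y a • fderiv ℝ (fun x => M x a) x) x :=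
    hf1.hasFDerivAt.add (HasFDerivAt.fun_sum fun a _ => (hM1 a).hasFDerivAt.const_mul (y a))
  simp only [gradVec, dotProduct, h.fderiv, Pi.add_apply, Matrix.mulVec, Matrix.transpose_apply,
    jacMat, Matrix.of_apply]
  simp [mul_comm]

variable [DecidableEq τ]

/-- The full gradient of the Lagrangian `(x, y) ↦ f x + yᵀ M x` of the program of minimizing `f`
subject to `M = 0`. -/
def lagrangeGrad (f : (σ → ℝ) → ℝ) (M : (σ → ℝ) → (τ → ℝ)) (w : (σ → ℝ) × (τ → ℝ)) :
    σ ⊕ τ → ℝ :=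
  Sum.elim (gradVec (fun x => f x + w.2 ⬝ᵥ M x) w.1)
    (gradVec (fun y => f w.1 + y ⬝ᵥ M w.1) w.2)

theorem gradVec_const_add_dotProduct (c : ℝ) (z y : τ → ℝ) :
    gradVec (fun y => c + y ⬝ᵥ z) y = z := by
  funext a
  have h : HasFDerivAt (fun y : τ → ℝ => c + ∑ a, y a * z a)
      (∑ a, z a • ContinuousLinearMap.proj (R := ℝ) (φ := fun _ : τ => ℝ) a) y :=
    (HasFDerivAt.fun_sum fun a _ => (hasFDerivAt_apply a y).mul_const (z a)).const_add c
  simp only [gradVec, dotProduct, h.fderiv]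
  simp [Pi.single_apply]

theorem lagrangeGrad_eq (hf : ContDiff ℝ 3 f) (hM : ContDiff ℝ 3 M) (w : (σ → ℝ) × (τ → ℝ)) :
    lagrangeGrad f M w =
      Sum.elim (gradVec f w.1 + (jacMat M w.1)ᵀ *ᵥ w.2) (M w.1) := by
  rw [lagrangeGrad, gradVec_add_dotProduct hf hM, gradVec_const_add_dotProduct]

theorem contDiff_gradVec {g : (σ → ℝ) → ℝ} (hg : ContDiff ℝ 3 g) : ContDiff ℝ 2 (gradVec g) :=
  contDiff_pi.2 fun _ => (hg.fderiv_right (m := 2) (by norm_num)).clm_apply contDiff_const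

theorem contDiff_lagrangeGrad (hf : ContDiff ℝ 3 f) (hM : ContDiff ℝ 3 M) :
    ContDiff ℝ 2 (lagrangeGrad f M) := by
  have h : lagrangeGrad f M = fun w =>
      Sum.elim (gradVec f w.1 + (jacMat M w.1)ᵀ *ᵥ w.2) (M w.1) :=
    funext (lagrangeGrad_eq hf hM)
  rw [h, contDiff_pi]
  rintro (i | a)
  · simp only [Sum.elim_inl, Pi.add_apply, Matrix.mulVec, dotProduct, Matrix.transpose_apply,
      jacMat, Matrix.of_apply]
    refine (contDiff_pi.1 ((contDiff_gradVec hf).comp contDiff_fst) i).add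
      (ContDiff.sum fun a _ => ContDiff.mul ?_ ?_)
    · exact contDiff_pi.1 ((contDiff_gradVec (contDiff_pi.1 hM a)).comp contDiff_fst) i
    · exact (contDiff_apply ℝ ℝ a).comp contDiff_snd
  · exact ((contDiff_pi.1 hM a).comp contDiff_fst).of_le (by norm_num)

/-- The derivative of the gradient of the Lagrangian is given by the matrix `[[H, Jᵀ], [J, 0]]`. In
coordinates the partial derivative in `x` comes out as `Hᵀ`, and the symmetry of the Hessian makes
it `H`. -/
theorem fderiv_lagrangeGrad_apply (hf : ContDiff ℝ 3 f) (hM : ContDiff ℝ 3 M)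
    (w v : (σ → ℝ) × (τ → ℝ)) :
    fderiv ℝ (lagrangeGrad f M) w v =
      Sum.elim (hessMat (fun x => f x + w.2 ⬝ᵥ M x) w.1 *ᵥ v.1 + (jacMat M w.1)ᵀ *ᵥ v.2)
        (jacMat M w.1 *ᵥ v.1) := by
  obtain ⟨x, y⟩ := w
  obtain ⟨p, q⟩ := v
  have hd : DifferentiableAt ℝ (lagrangeGrad f M) (x, y) :=
    (contDiff_lagrangeGrad hf hM).differentiable (by norm_num) _
  have hl : ContDiff ℝ 3 (fun x => f x + y ⬝ᵥ M x) := by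
    simp only [dotProduct]
    exact hf.add (ContDiff.sum fun a _ => contDiff_const.mul (contDiff_pi.1 hM a))
  -- the partial derivatives in `x` and in `y` are computed separately
  have hsplit : (p, q) = (p, (0 : τ → ℝ)) + ((0 : σ → ℝ), q) := by simp
  have h1 : fderiv ℝ (lagrangeGrad f M) (x, y) (p, 0) =
      Sum.elim (hessMat (fun x => f x + y ⬝ᵥ M x) x *ᵥ p) (jacMat M x *ᵥ p) := by
    have hx := hd.hasFDerivAt.comp x (hasFDerivAt_prodMk_left (𝕜 := ℝ) x y)
    funext s
    have hs := (hasFDerivAt_pi'.1 hx s).fderiv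
    have e : fderiv ℝ (lagrangeGrad f M) (x, y) (p, 0) s =
        fderiv ℝ (fun x => lagrangeGrad f M (x, y) s) x p := by
      simp only [Function.comp_def] at hs
      rw [hs]; simp
    rw [e, fderiv_apply_eq_dotProduct_gradVec]
    rcases s with i | a
    · rw [Sum.elim_inl, ← hessMat_transpose (hl.of_le (by norm_num)), dotProduct_comm]
      rfl
    · simp only [lagrangeGrad_eq hf hM, Sum.elim_inr]
      rw [dotProduct_comm]
      rfl
  have h2 : fderiv ℝ (lagrangeGrad f M) (x, y) (0, q) =
      Sum.elim ((jacMat M x)ᵀ *ᵥ q) 0 := by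
    have hy := hd.hasFDerivAt.comp y (hasFDerivAt_prodMk_right x y)
    have hy' : HasFDerivAt (lagrangeGrad f M ∘ fun y => (x, y))
        (ContinuousLinearMap.pi fun s : σ ⊕ τ => Sum.elim
          (fun i => (ContinuousLinearMap.proj (R := ℝ) (φ := fun _ : σ => ℝ) i).comp
            (LinearMap.toContinuousLinearMap (Matrix.mulVecLin (jacMat M x)ᵀ)))
          (fun _ => 0) s) y := by
      rw [hasFDerivAt_pi']
      rintro (i | a)
      · have := ((hasFDerivAt_apply i _).comp y (LinearMap.toContinuousLinearMap
          (Matrix.mulVecLin (jacMat M x)ᵀ)).hasFDerivAt).const_add (gradVec f x i)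
        simp only [Function.comp_def, lagrangeGrad_eq hf hM, Sum.elim_inl]
        exact this
      · simp only [Function.comp_def, lagrangeGrad_eq hf hM, Sum.elim_inr]
        exact hasFDerivAt_const _ _
    have := congrArg (fun A => A q) (hy.unique hy')
    simp only [ContinuousLinearMap.comp_apply, ContinuousLinearMap.inr_apply] at this
    rw [this]
    funext s
    rcases s with i | a <;> simp [Matrix.mulVec_transpose]
  rw [hsplit, map_add, h1, h2]
  funext s
  rcases s with i | a <;> simp

/-- Finsler's lemma, locally uniformly: if `H` is positive definite on the kernel of `J` at `ws`, then
`H + t JᵀJ` is positive definite for some `t`, and by compactness of the unit sphere this persists,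
with the same `t` and a uniform modulus, at all points close to `ws`. -/
theorem exists_eventually_norm_sq_le_hess_add_jac (hf : ContDiff ℝ 3 f) (hM : ContDiff ℝ 3 M)
    {ws : (σ → ℝ) × (τ → ℝ)}
    (hpos : ∀ u : σ → ℝ, u ≠ 0 → jacMat M ws.1 *ᵥ u = 0 →
      0 < u ⬝ᵥ (hessMat (fun x => f x + ws.2 ⬝ᵥ M x) ws.1 *ᵥ u)) :
    ∃ c > 0, ∃ t > 0, ∀ᶠ w in 𝓝 ws, ∀ u : σ → ℝ, c * ‖u‖ ^ 2 ≤
      u ⬝ᵥ (hessMat (fun x => f x + w.2 ⬝ᵥ M x) w.1 *ᵥ u) +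
        t * (jacMat M w.1 *ᵥ u ⬝ᵥ jacMat M w.1 *ᵥ u) := by
  set Q : ℝ → (σ → ℝ) × (τ → ℝ) → (σ → ℝ) → ℝ := fun t w u =>
    u ⬝ᵥ (hessMat (fun x => f x + w.2 ⬝ᵥ M x) w.1 *ᵥ u) +
        t * (jacMat M w.1 *ᵥ u ⬝ᵥ jacMat M w.1 *ᵥ u) with hQ
  have hcont : ∀ t, Continuous fun z : ((σ → ℝ) × (τ → ℝ)) × (σ → ℝ) => Q t z.1 z.2 := by
    intro t
    have h0 : Continuous fun z : ((σ → ℝ) × (τ → ℝ)) × (σ → ℝ) =>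
        fderiv ℝ (lagrangeGrad f M) z.1 (z.2, 0) :=
      ((contDiff_lagrangeGrad hf hM).continuous_fderiv (by norm_num)).comp continuous_fst
        |>.clm_apply (by fun_prop)
    have hH : Continuous fun z : ((σ → ℝ) × (τ → ℝ)) × (σ → ℝ) =>
        hessMat (fun x => f x + z.1.2 ⬝ᵥ M x) z.1.1 *ᵥ z.2 := by
      refine continuous_pi fun i => ((continuous_apply (Sum.inl i)).comp h0).congr fun z => ?_
      simp [fderiv_lagrangeGrad_apply hf hM]
    have hJ : Continuous fun z : ((σ → ℝ) × (τ → ℝ)) × (σ → ℝ) => jacMat M z.1.1 *ᵥ z.2 := by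
      refine continuous_pi fun i => ((continuous_apply (Sum.inr i)).comp h0).congr fun z => ?_
      simp [fderiv_lagrangeGrad_apply hf hM]
    exact (continuous_snd.dotProduct hH).add (continuous_const.mul (hJ.dotProduct hJ))
  have hmono : ∀ w u, Monotone fun t => Q t w u := fun w u s t hst => by
    have h : 0 ≤ jacMat M w.1 *ᵥ u ⬝ᵥ jacMat M w.1 *ᵥ u :=
      Finset.sum_nonneg fun i _ => mul_self_nonneg _
    simp only [hQ]
    gcongr
  have hhom : ∀ t w (a : ℝ) u, Q t w (a • u) = a ^ 2 * Q t w u := fun t w a u => by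
    simp only [hQ, Matrix.mulVec_smul, dotProduct_smul, smul_dotProduct, smul_eq_mul]
    ring
  have hS : IsCompact (Metric.sphere (0 : σ → ℝ) 1) := isCompact_sphere _ _
  have hc1 : ∀ t w, Continuous (Q t w) := fun t w =>
    (hcont t).comp (Continuous.prodMk continuous_const continuous_id)
  -- the open sets `{u | 0 < Q k ws u}` increase with `k` and exhaust the sphere
  obtain ⟨k, hk⟩ := hS.elim_directed_cover (fun k : ℕ => {u | 0 < Q (k + 1) ws u})
    (fun k => isOpen_lt continuous_const (hc1 _ _))
    (fun u hu => by
      have hu0 : u ≠ 0 := by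
        rintro rfl
        simp at hu
      simp only [Set.mem_iUnion, Set.mem_ofPred_eq]
      by_cases hJ : jacMat M ws.1 *ᵥ u = 0
      · refine ⟨0, ?_⟩
        have := hpos u hu0 hJ
        simpa [hQ, hJ] using this
      · have hJJ : 0 < jacMat M ws.1 *ᵥ u ⬝ᵥ jacMat M ws.1 *ᵥ u :=
          lt_of_le_of_ne (Finset.sum_nonneg fun i _ => mul_self_nonneg _)
            (fun h => hJ (dotProduct_self_eq_zero.1 h.symm))
        obtain ⟨k, hk⟩ := exists_nat_gt
          (-(u ⬝ᵥ (hessMat (fun x => f x + ws.2 ⬝ᵥ M x) ws.1 *ᵥ u)) /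
            (jacMat M ws.1 *ᵥ u ⬝ᵥ jacMat M ws.1 *ᵥ u))
        rw [div_lt_iff₀ hJJ] at hk
        refine ⟨k, ?_⟩
        simp only [hQ]
        linarith)
    (directed_of_isDirected_le fun i j hij u hu =>
      lt_of_lt_of_le (show 0 < Q (i + 1) ws u from hu) (hmono ws u (by gcongr)))
  obtain ⟨c, hc, hck⟩ := hS.exists_forall_le' (hc1 (k + 1) ws).continuousOn (a := 0)
    (fun u hu => hk hu)
  refine ⟨c / 2, by positivity, k + 1, by positivity, ?_⟩
  have hev := hS.eventually_forall_of_forall_eventually (x₀ := ws)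
    (P := fun w u => c / 2 < Q (k + 1) w u) (fun u hu =>
      (hcont (k + 1)).tendsto (ws, u) |>.eventually (lt_mem_nhds (by
        have := hck u hu
        simp only
        linarith)))
  filter_upwards [hev] with w hw u
  change _ ≤ Q (k + 1) w u
  rcases eq_or_ne u 0 with rfl | hu
  · simp [hQ]
  · have hn : ‖u‖ ≠ 0 := norm_ne_zero_iff.2 hu
    have h1 := hw (‖u‖⁻¹ • u) (by simp [norm_smul, hn])
    have h2 : u = ‖u‖ • (‖u‖⁻¹ • u) := by rw [smul_smul, mul_inv_cancel₀ hn, one_smul]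
    have h3 := hhom (k + 1) w ‖u‖ (‖u‖⁻¹ • u)
    rw [← h2] at h3
    rw [h3, mul_comm]
    gcongr

end Coordinates

/-! ### Regularized Newton iteration for equality constrained programs -/

section Program

variable {σ τ : Type*} [Fintype σ] [DecidableEq σ] [Fintype τ] [DecidableEq τ]
  {f : (σ → ℝ) → ℝ} {M : (σ → ℝ) → (τ → ℝ)}

/-- The regularized matrix `[[∇²_xx L, Jᵀ], [J, -μ I]]`, `μ = ‖∇L‖₁`, of the Lagrangian
`L(x, y) = f x + yᵀ M x`. -/
def regularizedKKT (f : (σ → ℝ) → ℝ) (M : (σ → ℝ) → (τ → ℝ)) (w : (σ → ℝ) × (τ → ℝ)) :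
    Matrix (σ ⊕ τ) (σ ⊕ τ) ℝ :=
  Matrix.fromBlocks (hessMat (fun x => f x + w.2 ⬝ᵥ M x) w.1) (jacMat M w.1)ᵀ (jacMat M w.1)
    (-(l1Norm (lagrangeGrad f M w) • (1 : Matrix τ τ ℝ)))

theorem lagrangeGrad_eq_zero_iff (hf : ContDiff ℝ 3 f) (hM : ContDiff ℝ 3 M)
    (w : (σ → ℝ) × (τ → ℝ)) :
    lagrangeGrad f M w = 0 ↔ gradVec f w.1 + (jacMat M w.1)ᵀ *ᵥ w.2 = 0 ∧ M w.1 = 0 := by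
  rw [lagrangeGrad_eq hf hM]
  constructor
  · intro h
    exact ⟨funext fun i => congrFun h (Sum.inl i), funext fun a => congrFun h (Sum.inr a)⟩
  · rintro ⟨h1, h2⟩
    rw [h1, h2]
    exact Sum.elim_zero_zero

/-- Under the second-order sufficiency condition, the kernel of `[[H, Jᵀ], [J, 0]]` is `0 × ker Jᵀ`. -/
theorem fst_eq_zero_of_fderiv_lagrangeGrad_eq_zero (hf : ContDiff ℝ 3 f) (hM : ContDiff ℝ 3 M)
    {ws : (σ → ℝ) × (τ → ℝ)}
    (hpos : ∀ u : σ → ℝ, u ≠ 0 → jacMat M ws.1 *ᵥ u = 0 →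
      0 < u ⬝ᵥ (hessMat (fun x => f x + ws.2 ⬝ᵥ M x) ws.1 *ᵥ u))
    {v : (σ → ℝ) × (τ → ℝ)} (hv : fderiv ℝ (lagrangeGrad f M) ws v = 0) :
    v.1 = 0 ∧ (jacMat M ws.1)ᵀ *ᵥ v.2 = 0 := by
  rw [fderiv_lagrangeGrad_apply hf hM] at hv
  have h1 : hessMat (fun x => f x + ws.2 ⬝ᵥ M x) ws.1 *ᵥ v.1 + (jacMat M ws.1)ᵀ *ᵥ v.2 = 0 :=
    funext fun i => congrFun hv (Sum.inl i)
  have h2 : jacMat M ws.1 *ᵥ v.1 = 0 := funext fun a => congrFun hv (Sum.inr a)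
  have h3 : v.1 = 0 := by
    by_contra h
    have h4 := hpos _ h h2
    rw [eq_neg_of_add_eq_zero_left h1, Matrix.mulVec_transpose, dotProduct_neg, dotProduct_comm,
      ← Matrix.dotProduct_mulVec, h2, dotProduct_zero, neg_zero] at h4
    exact lt_irrefl _ h4
  refine ⟨h3, ?_⟩
  rwa [h3, Matrix.mulVec_zero, zero_add] at h1

/-- Local quadratic convergence of the regularized Newton iteration for minimizing `f` subject to
`M = 0`, near a point satisfying the second-order sufficiency conditions and without any
constraint qualification. -/
theorem exists_regularizedNewton_quadraticallyConverges (hf : ContDiff ℝ 3 f)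
    (hM : ContDiff ℝ 3 M) {xs : σ → ℝ} {ys : τ → ℝ} (h0 : lagrangeGrad f M (xs, ys) = 0)
    (hpos : ∀ u : σ → ℝ, u ≠ 0 → jacMat M xs *ᵥ u = 0 →
      0 < u ⬝ᵥ (hessMat (fun x => f x + ys ⬝ᵥ M x) xs *ᵥ u))
    {Step : (σ → ℝ) × (τ → ℝ) → (σ → ℝ) × (τ → ℝ) → Prop}
    (hStep : ∀ w w', Step w w' ↔
      regularizedKKT f M w *ᵥ Sum.elim (w'.1 - w.1) (w'.2 - w.2) = - lagrangeGrad f M w ∧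
        (lagrangeGrad f M w = 0 → w' = w)) :
    ∃ ρ > 0, ∃ C > 0, ∀ w₀ : (σ → ℝ) × (τ → ℝ), ‖w₀ - (xs, ys)‖ < ρ →
      (∃! w : ℕ → (σ → ℝ) × (τ → ℝ), w 0 = w₀ ∧ ∀ k, Step (w k) (w (k + 1))) ∧
      ∀ w : ℕ → (σ → ℝ) × (τ → ℝ), (w 0 = w₀ ∧ ∀ k, Step (w k) (w (k + 1))) →
        ∃ yh : τ → ℝ, lagrangeGrad f M (xs, yh) = 0 ∧ ‖yh - ys‖ ≤ C * ‖w₀ - (xs, ys)‖ ∧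
          QuadraticallyConverges w (xs, yh) C := by
  set F := lagrangeGrad f M with hFdef
  have hF : ContDiff ℝ 2 F := contDiff_lagrangeGrad hf hM
  have hker := fun v => fst_eq_zero_of_fderiv_lagrangeGrad_eq_zero hf hM (ws := (xs, ys))
    hpos (v := v)
  -- along the kernel of the derivative only the multiplier moves, and the gradient, which is affine
  -- in the multiplier, stays zero
  have hzero : ∀ v, fderiv ℝ F (xs, ys) v = 0 → F ((xs, ys) + v) = 0 := by
    intro v hv
    obtain ⟨h1, h2⟩ := hker v hv
    have h3 := (lagrangeGrad_eq_zero_iff hf hM _).1 h0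
    refine (lagrangeGrad_eq_zero_iff hf hM _).2 ?_
    simp only [Prod.fst_add, Prod.snd_add, h1, add_zero, Matrix.mulVec_add, h2]
    exact h3
  obtain ⟨C₁, hC₁, herr⟩ :=
    (hF.contDiffAt.hasStrictFDerivAt (by norm_num)).eventually_exists_norm_sub_le hzero
  obtain ⟨c, hc, t, ht, hev⟩ := exists_eventually_norm_sq_le_hess_add_jac hf hM
    (ws := (xs, ys)) hpos
  obtain ⟨C₂, hC₂, μ₀, hμ₀, hbd⟩ := exists_regularized_saddle_bound (σ := σ) (τ := τ) hc ht
  set T : (σ → ℝ) × (τ → ℝ) →L[ℝ] (σ ⊕ τ → ℝ) := LinearMap.toContinuousLinearMap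
    ((LinearEquiv.sumArrowLequivProdArrow σ τ ℝ ℝ).symm.toLinearMap ∘ₗ
      LinearMap.inr ℝ (σ → ℝ) (τ → ℝ) ∘ₗ LinearMap.snd ℝ (σ → ℝ) (τ → ℝ)) with hT
  have hTv : ∀ v, T v = Sum.elim (0 : σ → ℝ) v.2 := fun v => by
    funext s; rcases s with i | a <;> rfl
  have hDT : ∀ w v (μ : ℝ), fderiv ℝ F w v - μ • T v =
      Sum.elim (hessMat (fun x => f x + w.2 ⬝ᵥ M x) w.1 *ᵥ v.1 + (jacMat M w.1)ᵀ *ᵥ v.2)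
        (jacMat M w.1 *ᵥ v.1 - μ • v.2) := fun w v μ => by
    rw [hTv, fderiv_lagrangeGrad_apply hf hM]
    funext s; rcases s with i | a <;> simp
  have hreg : ∀ w (v : (σ → ℝ) × (τ → ℝ)), regularizedKKT f M w *ᵥ Sum.elim v.1 v.2 =
      fderiv ℝ F w v - l1Norm (F w) • T v := fun w v => by
    rw [hDT, regularizedKKT, Matrix.fromBlocks_mulVec]
    funext s; rcases s with i | a <;>
      simp [Matrix.neg_mulVec, Matrix.smul_mulVec, sub_eq_add_neg, hFdef]
  obtain ⟨C, hC, hst⟩ := exists_regularizedNewton_step_bound (Step := Step) (by simp) hF h0 T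
    (μ := fun w => l1Norm (F w)) (C₀ := Fintype.card (σ ⊕ τ) + 1) (by positivity)
    (fun w => norm_le_l1Norm _)
    (fun w => (l1Norm_le_card_mul_norm _).trans (by gcongr; linarith)) hC₁
    (herr.mono fun w ⟨z, hz, hwz⟩ => ⟨_, hzero z hz, hwz⟩) hC₂ hμ₀
    (hev.mono fun w hw μ hμ hμ' v => by
      rw [hDT]
      exact hbd _ _ hw μ hμ hμ' v.1 v.2)
    (fun w w' => by
      rw [hStep, ← hreg]; rfl)
  obtain ⟨ρ, hρ, C', hC', h⟩ := exists_quadraticallyConverges_of_step_bound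
    (hF.of_le (by norm_num)) h0 hC hst herr
  refine ⟨ρ, hρ, C', hC', fun w₀ hw₀ => ⟨(h w₀ hw₀).1, fun w hw => ?_⟩⟩
  obtain ⟨wh, ⟨z, hz, hwz⟩, hFwh, hdist, hquad⟩ := (h w₀ hw₀).2 w hw
  -- by the error bound, a zero of the gradient close to `(xs, ys)` differs from it by an element of
  -- the kernel of the derivative, so that its first component is `xs`
  rw [hFwh, norm_zero, mul_zero, norm_le_zero_iff, sub_eq_zero] at hwz
  have hwh : wh = (xs, wh.2) := by
    refine Prod.ext ?_ rfl
    rw [hwz]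
    simp [(hker z hz).1]
  refine ⟨wh.2, hwh ▸ hFwh, ?_, hwh ▸ hquad⟩
  exact (norm_snd_le (wh - (xs, ys))).trans hdist

/-- If the Jacobian of the constraints has full row rank, the multiplier is unique. -/
theorem lagrangeMultiplier_unique (hf : ContDiff ℝ 3 f)
    (hM : ContDiff ℝ 3 M) {x : σ → ℝ} {y y' : τ → ℝ} (hy : lagrangeGrad f M (x, y) = 0)
    (hy' : lagrangeGrad f M (x, y') = 0) (hJ : LinearIndependent ℝ (jacMat M x).row) : y' = y := by
  have h1 := ((lagrangeGrad_eq_zero_iff hf hM _).1 hy).1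
  have h2 := ((lagrangeGrad_eq_zero_iff hf hM _).1 hy').1
  have h3 : (jacMat M x)ᵀ *ᵥ y' = (jacMat M x)ᵀ *ᵥ y := add_left_cancel (h2.trans h1.symm)
  rw [Matrix.mulVec_transpose, Matrix.mulVec_transpose] at h3
  exact Matrix.vecMul_injective_iff.2 hJ h3

end Program

/-! ### Smoothness of the low rank approximation problem -/

namespace LowRankProblem

variable {n r m : ℕ} (P : LowRankProblem n r m)

theorem coeff_deltaA (x : P.Var → ℝ) (i j : Fin n) (k : ℕ) :
    (P.deltaA x i j).coeff k = ∑ s, x (Sum.inl s) * (P.E s i j).coeff k := by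
  simp [deltaA, Matrix.sum_apply, Polynomial.finsetSum_coeff]

theorem contDiff_coeff_deltaA (i j : Fin n) (k : ℕ) {d : WithTop ℕ∞} :
    ContDiff ℝ d fun x => (P.deltaA x i j).coeff k := by
  simp only [coeff_deltaA]
  exact ContDiff.sum fun s _ => (contDiff_apply ℝ ℝ _).mul contDiff_const

theorem contDiff_frobSq_deltaA {d : WithTop ℕ∞} :
    ContDiff ℝ d fun x => frobSq (P.deltaA x) := by
  simp only [frobSq]
  refine ContDiff.sum fun i _ => ContDiff.sum fun j _ => ?_
  -- a bound for the degree that does not depend on `x`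
  set N := ∑ s, ((P.E s i j).natDegree + 1)
  have h : ∀ x, (P.deltaA x i j).sum (fun _ a => a ^ 2) =
      ∑ k ∈ Finset.range (N + 1), (P.deltaA x i j).coeff k ^ 2 := fun x => by
    refine Polynomial.sum_over_range' _ (fun _ => by simp) _ (Nat.lt_succ_of_le ?_)
    refine Polynomial.natDegree_le_iff_coeff_eq_zero.2 fun k hk => ?_
    rw [coeff_deltaA]
    refine Finset.sum_eq_zero fun s _ => ?_
    have : (P.E s i j).natDegree + 1 ≤ N :=
      Finset.single_le_sum (f := fun s => (P.E s i j).natDegree + 1) (fun _ _ => Nat.zero_le _)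
        (Finset.mem_univ s)
    rw [Polynomial.coeff_eq_zero_of_natDegree_lt (by omega), mul_zero]
  simp only [h]
  exact ContDiff.sum fun k _ => (P.contDiff_coeff_deltaA i j k).pow 2

theorem contDiff_residual {d : WithTop ℕ∞} (hnrm : ∀ j, ContDiff ℝ d (P.nrm j)) :
    ContDiff ℝ d P.residual := by
  have hker : ∀ j, ContDiff ℝ d fun x => P.kerVec x j := fun j =>
    contDiff_pi.2 fun s => contDiff_apply ℝ ℝ _
  rw [contDiff_pi]
  rintro (q | j)
  · simp only [residual, Sum.elim_inl, Matrix.mulVec, dotProduct]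
    refine ContDiff.sum fun s _ => ContDiff.mul ?_ (contDiff_pi.1 (hker q.1) s)
    simp only [block, realEmbedding, Matrix.submatrix_apply, Matrix.of_apply, toeplitz,
      Matrix.add_apply, Polynomial.coeff_add]
    split_ifs
    · exact contDiff_const.add (P.contDiff_coeff_deltaA _ _ _)
    · exact contDiff_const
  · simp only [residual, Sum.elim_inr, dotProduct]
    refine (ContDiff.sum fun s _ => ContDiff.mul ?_ (contDiff_pi.1 (hker j) s)).sub contDiff_const
    exact contDiff_pi.1 ((hnrm j).comp (hker j)) s

end LowRankProblem

end

theorem mainTheorem5 {n r m : ℕ} (P : LowRankProblem n r m)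
    (hnrm : ∀ j, ContDiff ℝ 3 (P.nrm j))
    (xs : P.Var → ℝ) (ys : P.Con → ℝ) (hopt : P.SecondOrderSufficient (xs, ys)) :
    ∃ ρ > 0, ∃ C > 0, ∀ w₀ : (P.Var → ℝ) × (P.Con → ℝ), ‖w₀ - (xs, ys)‖ < ρ →
      (∃! w, P.IsRun w₀ w) ∧
      ∀ w, P.IsRun w₀ w →
        ∃ yh : P.Con → ℝ,
          P.gradL (xs, yh) = 0 ∧
          ‖yh - ys‖ ≤ C * ‖w₀ - (xs, ys)‖ ∧
          (LinearIndependent ℝ (P.jac xs).row → yh = ys) ∧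
          QuadraticallyConverges w (xs, yh) C := by
  have hf : ContDiff ℝ 3 fun x => frobSq (P.deltaA x) := P.contDiff_frobSq_deltaA
  have hM : ContDiff ℝ 3 P.residual := P.contDiff_residual hnrm
  obtain ⟨ρ, hρ, C, hC, h⟩ := exists_regularizedNewton_quadraticallyConverges hf hM
    hopt.1 hopt.2 (Step := P.IsStep) fun _ _ => Iff.rfl
  refine ⟨ρ, hρ, C, hC, fun w₀ hw₀ => ⟨(h w₀ hw₀).1, fun w hw => ?_⟩⟩
  obtain ⟨yh, hyh, hdist, hquad⟩ := (h w₀ hw₀).2 w hw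
  exact ⟨yh, hyh, hdist, fun hJ => lagrangeMultiplier_unique hf hM hopt.1 hyh hJ, hquad⟩
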